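/- Let $p\ge 3$ and $0<\theta<1/2$. Let $\mathcal D(\mathcal T^p,\theta)$ be the set of all probability distributions $Q$ on $\{0,1\}^p$ for which there is a tree $T_Q=(\{1,\dots,p\},\mathcal E_Q)$ (a connected acyclic graph) such that: (i) $Q$ is Markov on $T_Q$, i.e. $Q(x_i\mid x_{\{1,\dots,p\}\setminus\{i\}})=Q(x_i\mid x_{\mathrm{nbd}(i)})$ for every node $i$, where $\mathrm{nbd}(i)$ is the set of neighbours of $i$ in $T_Q$; (ii) all one-node marginals are uniform, $Q_i(0)=Q_i(1)=1/2$; (iii) $Q_{i,j}(0,1)=Q_{i,j}(1,0)=\theta/2$ for every edge $\{i,j\}\in\mathcal E_Q$. Let $P\in\mathcal D(\mathcal T^p,\theta)$ have tree $(\{1,\dots,p\},\mathcal E_P)$, and let $\mathbf x_1,\mathbf x_2,\dots$ be i.i.d. samples from $P$. For each $n$ let $P_{\mathrm{ML}}(\mathbf x^n)$ be a maximizer of $\sum_{k=1}^n\log Q(\mathbf x_k)$ over $Q\in\mathcal D(\mathcal T^p,\theta)$, with ties broken in an arbitrary (possibly random) way, and let $\mathcal E_{\mathrm{ML}}(\mathbf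 x^n)$ be the edge set of its tree. Then the error exponent of maximum likelihood structure learning exists and equals $$K_P:=\lim_{n\to\infty}-\frac1n\log\mathbb P\big(\mathcal E_{\mathrm{ML}}(\mathbf x^n)\neq\mathcal E_P\big)=-\log\Big(1-\theta\big(1-\sqrt{4\theta(1-\theta)}\big)\Big).$$ In particular, $K_P$ does not depend on $p$ or on the tree $\mathcal E_P$. -/

import Mathlib

open MeasureTheory ProbabilityTheory Filter Topology

namespace TreeLearning

/-- Local Markov property of a distribution `P` on `{0,1}^p` with respect to a graph `G`:
`P(x_i | x_{V \ i}) = P(x_i | x_{nbd(i)})` for all nodes `i` and all `x` for which the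
conditioning event on the left has positive probability. -/
def IsMarkov {p : ℕ} (G : SimpleGraph (Fin p)) (P : Measure (Fin p → Bool)) : Prop :=
  ∀ (i : Fin p) (x : Fin p → Bool),
    P {y | ∀ j, j ≠ i → y j = x j} ≠ 0 →
      P[{y | y i = x i} | {y | ∀ j, j ≠ i → y j = x j}] =
        P[{y | y i = x i} | {y | ∀ j, G.Adj i j → y j = x j}]

/-- `P` is a tree-structured graphical model on `{0,1}^p` with tree `T`, uniform marginals, and
`P_{i,j}(0,1) = P_{i,j}(1,0) = θ/2` on every edge `{i,j}` of `T`. -/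
structure IsTreeModel {p : ℕ} (θ : ℝ) (T : SimpleGraph (Fin p))
    (P : Measure (Fin p → Bool)) : Prop where
  isTree : T.IsTree
  isProbabilityMeasure : IsProbabilityMeasure P
  isMarkov : IsMarkov T P
  uniform : ∀ (i : Fin p) (b : Bool), P.real {x | x i = b} = 1 / 2
  homogeneous : ∀ i j : Fin p, T.Adj i j →
    P.real {x | x i = false ∧ x j = true} = θ / 2 ∧
      P.real {x | x i = true ∧ x j = false} = θ / 2

/-- The class of all tree models on `p` nodes with parameter `θ`. -/
def treeModels (p : ℕ) (θ : ℝ) : Set (Measure (Fin p → Bool)) :=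
  {P | ∃ T : SimpleGraph (Fin p), IsTreeModel θ T P}

/-- The log-likelihood of the samples `x` under `Q`. -/
noncomputable def logLikelihood {p n : ℕ} (x : Fin n → Fin p → Bool)
    (Q : Measure (Fin p → Bool)) : ℝ :=
  ∑ k, Real.log (Q.real {x k})

/-- `Q` is a maximum likelihood estimate, within the class of all tree models with
parameter `θ`, for the samples `x`. -/
def IsMLEstimate {p n : ℕ} (θ : ℝ) (x : Fin n → Fin p → Bool)
    (Q : Measure (Fin p → Bool)) : Prop :=
  Q ∈ treeModels p θ ∧ IsMaxOn (logLikelihood x) (treeModels p θ) Q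

end TreeLearning

/-!
The likelihood of a tree model factorises over the edges of its tree, so a maximum likelihood tree
is one that minimises the number of samples whose labels differ along an edge, summed over all
edges. By an exchange argument such a tree is wrong only if some non-edge `e'` of the true tree
shows at most as many disagreements as an edge `e` on the path between the ends of `e'`, and it is
wrong whenever this happens with strict inequality on a path of length two. For fixed `e'` and `e`
the difference of the two numbers of disagreements is a random walk with increments in `{-1, 0, 1}`.
It moves up with probability `(1 - θ) * q` and down with probability `θ * q`, where `q` is the
probability of an odd number of flips on the rest of the path. A walk with up and down probabilities
`u > v` is back at or below its start after `n` steps with probability `(1 - (√u - √v) ^ 2) ^ n` up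
to polynomial factors: the upper bound is Chernoff's, and the lower bound estimates a central
coefficient of the generating polynomial. Here `(√u - √v) ^ 2 = q * (1 - √(4 * θ * (1 - θ)))`, which
is smallest for the paths of length two, where `q = θ`; so these dominate whatever the tree is.
-/

namespace TreeLearning

section Graph

variable {V : Type*} {T T' : SimpleGraph V} {i j : V}

theorem exists_mem_subsingleton_neighbors (hT : T.IsTree) {S : Set V} (hfin : S.Finite)
    (hS : S.Nonempty) : ∃ l ∈ S, (S ∩ T.neighborSet l).Subsingleton := by
  classical
  obtain ⟨r⟩ := hT.connected.nonempty
  -- A vertex of `S` at maximal distance from the root: its only neighbour in `S` is its parent.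
  obtain ⟨l, hl, hmax⟩ := S.exists_max_image (T.dist r) hfin hS
  obtain ⟨p, hp, -⟩ := (hT.connected r l).exists_path_of_dist
  have eq_parent : ∀ a ∈ S, T.Adj l a → a = p.penultimate := by
    intro a ha hla
    obtain ⟨q, hq, hqd⟩ := (hT.connected r a).exists_path_of_dist
    have hlt : T.dist r a < T.dist r l :=
      lt_of_le_of_ne (hmax a ha) (hT.dist_ne_of_adj r hla).symm
    have hnot : l ∉ q.support := fun h => by
      have := (SimpleGraph.dist_le (q.takeUntil l h)).trans (q.length_takeUntil_le_length h)
      omega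
    exact hT.isAcyclic.eq_penultimate_of_adj_end hp hla
      (hT.isAcyclic.mem_support_of_ne_mem_support_of_adj_of_isPath hp hq hla hnot)
  exact ⟨l, hl, fun a ha b hb => (eq_parent a ha.1 ha.2).trans (eq_parent b hb.1 hb.2).symm⟩

theorem not_reachable_deleteEdges (hT : T.IsAcyclic) (hij : T.Adj i j) :
    ¬ (T.deleteEdges {s(i, j)}).Reachable i j :=
  SimpleGraph.isBridge_iff.mp (SimpleGraph.isAcyclic_iff_forall_adj_isBridge.mp hT hij)

theorem sum_edgeFinset_exchange {M : Type*} [AddCommMonoid M] {e : Sym2 V} (he : e ∈ T.edgeSet)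
    {a b : V} (hab : ¬ (T.deleteEdges {e}).Reachable a b) [Fintype T.edgeSet]
    [Fintype (T.deleteEdges {e} ⊔ SimpleGraph.edge a b).edgeSet] (f : Sym2 V → M) :
    ∑ e' ∈ (T.deleteEdges {e} ⊔ SimpleGraph.edge a b).edgeFinset, f e' + f e =
      ∑ e' ∈ T.edgeFinset, f e' + f s(a, b) := by
  classical
  have hne : a ≠ b := fun h => hab (h ▸ .rfl)
  have hedges : (T.deleteEdges {e} ⊔ SimpleGraph.edge a b).edgeFinset =
      insert s(a, b) (T.edgeFinset.erase e) := by
    ext e'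
    simp [SimpleGraph.edgeSet_deleteEdges, SimpleGraph.edgeSet_edge_of_ne hne, and_comm]
  have hnot : s(a, b) ∉ T.edgeFinset.erase e := fun h =>
    hab (SimpleGraph.Adj.reachable (by simpa [and_comm] using h))
  rw [hedges, Finset.sum_insert hnot, add_assoc,
    Finset.sum_erase_add _ _ (SimpleGraph.mem_edgeFinset.mpr he), add_comm]

theorem isTree_deleteEdges_sup_edge [Finite V] (hT : T.IsTree) {e : Sym2 V}
    (he : e ∈ T.edgeSet) {a b : V} (hab : ¬ (T.deleteEdges {e}).Reachable a b) :
    (T.deleteEdges {e} ⊔ SimpleGraph.edge a b).IsTree := by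
  classical
  have := Fintype.ofFinite V
  have := hT.connected.nonempty
  have hacyclic : (T.deleteEdges {e} ⊔ SimpleGraph.edge a b).IsAcyclic :=
    (hT.isAcyclic.anti (T.deleteEdges_le _)).sup_edge_of_not_reachable hab
  -- An acyclic graph with as many edges as a tree is the spanning tree that extends it.
  obtain ⟨F, hle, -, hF⟩ :=
    SimpleGraph.connected_top.exists_isTree_le_of_le_of_isAcyclic le_top hacyclic
  have hcard := sum_edgeFinset_exchange he hab fun _ => 1
  simp only [Finset.sum_const, smul_eq_mul, mul_one] at hcard
  have hTcard := hT.card_edgeFinset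
  have hFcard := hF.card_edgeFinset
  have hedges := Finset.eq_of_subset_of_card_le (SimpleGraph.edgeFinset_subset_edgeFinset.mpr hle)
    (by omega)
  rwa [SimpleGraph.edgeFinset_inj.mp hedges]

theorem exists_mem_edges_not_reachable (w : T.Walk i j) (hij : ¬ T'.Reachable i j) :
    ∃ a b, s(a, b) ∈ w.edges ∧ ¬ T'.Reachable a b := by
  obtain ⟨d, hd, ha, hb⟩ := w.exists_boundary_dart {v | T'.Reachable i v} .rfl hij
  exact ⟨d.fst, d.snd, List.mem_map.mpr ⟨d, hd, rfl⟩, fun h => hb (ha.trans h)⟩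

theorem exists_adj_not_adj (hT : T.IsTree) (hT' : T'.IsTree) (hne : T' ≠ T) :
    ∃ i j, T'.Adj i j ∧ ¬ T.Adj i j := by
  by_contra! h
  exact hne <| le_antisymm h
    ((SimpleGraph.isTree_iff_minimal_connected.mp hT).2 hT'.connected h)

theorem exists_two_neighbors [Fintype V] (hT : T.IsTree) (hV : 2 < Fintype.card V) :
    ∃ a i j, T.Adj a i ∧ T.Adj a j ∧ i ≠ j := by
  classical
  have hsum : ∑ v, T.degree v = 2 * T.edgeFinset.card := T.sum_degrees_eq_twice_card_edges
  have hcard := hT.card_edgeFinset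
  obtain ⟨a, -, ha⟩ : ∃ a ∈ Finset.univ, 1 < T.degree a := by
    apply Finset.exists_lt_of_sum_lt
    simp only [Finset.sum_const, Finset.card_univ, smul_eq_mul]
    omega
  obtain ⟨i, hi, j, hj, hij⟩ := Finset.one_lt_card.mp ha
  exact ⟨a, i, j, by simpa using hi, by simpa using hj, hij⟩

/-- The pairs `(e', e)` of a non-edge `e'` of `T` and an edge `e` on the path of `T` between the
ends of `e'`. Exchanging `e` for `e'` turns the tree `T` into another tree; such an exchange is the
basic error of structure learning. -/
def crossoverPairs (T : SimpleGraph V) : Set (Sym2 V × Sym2 V) :=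
  {q | ∃ (i j : V) (w : T.Walk i j), w.IsPath ∧ ¬ T.Adj i j ∧ q.1 = s(i, j) ∧ q.2 ∈ w.edges}

end Graph

section Density

variable {V : Type*}

/-- Whether the labelling `x` takes different values at the two ends of `e`. -/
def differ (x : V → Bool) (e : Sym2 V) : Bool :=
  Sym2.lift ⟨fun i j => xor (x i) (x j), fun _ _ => Bool.xor_comm _ _⟩ e

@[simp]
theorem differ_mk (x : V → Bool) (i j : V) : differ x s(i, j) = xor (x i) (x j) := rfl

theorem differ_congr {x y : V → Bool} {e : Sym2 V} (h : ∀ i ∈ e, x i = y i) :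
    differ x e = differ y e := by
  induction e with
  | _ i j => rw [differ_mk, differ_mk, h i (by simp), h j (by simp)]

/-- The mass function of a Bernoulli variable with parameter `θ`. -/
def bern (θ : ℝ) (b : Bool) : ℝ := if b then θ else 1 - θ

/-- The sign `(-1)^b`. -/
def sgn (b : Bool) : ℝ := if b then -1 else 1

theorem bern_pos {θ : ℝ} (h0 : 0 < θ) (h1 : θ < 1) (b : Bool) : 0 < bern θ b := by
  cases b <;> simp [bern] <;> linarith

theorem sgn_xor (a b : Bool) : sgn (xor a b) = sgn a * sgn b := by
  cases a <;> cases b <;> simp [sgn]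

theorem sgn_mul_self (b : Bool) : sgn b * sgn b = 1 := by
  cases b <;> simp [sgn]

theorem sgn_differ_eq_prod_edges {T : SimpleGraph V} (x : V → Bool) {i j : V} (w : T.Walk i j) :
    sgn (differ x s(i, j)) = (w.edges.map fun e => sgn (differ x e)).prod := by
  induction w with
  | @nil u => simp [sgn]
  | @cons a b c h w ih =>
    rw [SimpleGraph.Walk.edges_cons, List.map_cons, List.prod_cons, ← ih]
    simp only [differ_mk, sgn_xor]
    linear_combination (-sgn (x a) * sgn (x c)) * sgn_mul_self (x b)

/-- The mass function of the tree model with tree `T`: a uniform label at one node, and independent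
flips of probability `θ` along the edges. -/
noncomputable def density (θ : ℝ) (T : SimpleGraph V) [Fintype T.edgeSet] (x : V → Bool) : ℝ :=
  1 / 2 * ∏ e ∈ T.edgeFinset, bern θ (differ x e)

theorem density_pos {θ : ℝ} (h0 : 0 < θ) (h1 : θ < 1) (T : SimpleGraph V) [Fintype T.edgeSet]
    (x : V → Bool) : 0 < density θ T x :=
  mul_pos (by norm_num) (Finset.prod_pos fun _ _ => bern_pos h0 h1 _)

variable {T : SimpleGraph V} [Fintype T.edgeSet]

theorem bijective_root_differ [Finite V] (hT : T.IsTree) (r : V) :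
    Function.Bijective
      (fun x : V → Bool => ((x r, fun e => differ x e) : Bool × (T.edgeFinset → Bool))) := by
  classical
  cases nonempty_fintype V
  rw [Fintype.bijective_iff_injective_and_card]
  constructor
  · intro x y hxy
    simp only [Prod.mk.injEq] at hxy
    obtain ⟨hr, he⟩ := hxy
    funext v
    obtain ⟨w⟩ := hT.connected v r
    induction w with
    | nil => exact hr
    | @cons a b c h _ ih =>
      have hab : xor (x a) (x b) = xor (y a) (y b) := congrFun he ⟨s(a, b), by simpa using h⟩
      simpa [ih hr] using hab
  · simp only [Fintype.card_fun, Fintype.card_bool, Fintype.card_prod, Fintype.card_coe]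
    rw [← hT.card_edgeFinset, pow_succ, mul_comm]

variable [Fintype V] [DecidableEq V]

theorem sum_root_mul_prod_differ {R : Type*} [CommSemiring R] (hT : T.IsTree) (r : V)
    (f : Bool → R) (g : Sym2 V → Bool → R) :
    ∑ x : V → Bool, f (x r) * ∏ e ∈ T.edgeFinset, g e (differ x e) =
      (∑ b, f b) * ∏ e ∈ T.edgeFinset, ∑ b, g e b := by
  simp only [← Finset.prod_coe_sort T.edgeFinset]
  rw [(bijective_root_differ hT r).sum_comp fun z => f z.1 * ∏ e : T.edgeFinset, g e (z.2 e),
    Fintype.sum_prod_type, Finset.sum_mul]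
  simp only [← Finset.mul_sum]
  rw [← Fintype.piFinset_univ, Finset.sum_prod_piFinset Finset.univ fun e : T.edgeFinset => g e]

theorem sum_density_mul (hT : T.IsTree) (θ : ℝ) (r : V) (f : Bool → ℝ) {F : Finset (Sym2 V)}
    (hF : F ⊆ T.edgeFinset) (g : Sym2 V → Bool → ℝ) :
    ∑ x : V → Bool, density θ T x * (f (x r) * ∏ e ∈ F, g e (differ x e)) =
      1 / 2 * (∑ b, f b) * ∏ e ∈ F, ∑ b, bern θ b * g e b := by
  have hrestrict : ∀ h : Sym2 V → ℝ,
      ∏ e ∈ F, h e = ∏ e ∈ T.edgeFinset, if e ∈ F then h e else 1 := fun h => by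
    rw [Finset.prod_ite_mem, Finset.inter_eq_right.mpr hF]
  calc ∑ x : V → Bool, density θ T x * (f (x r) * ∏ e ∈ F, g e (differ x e))
      = ∑ x : V → Bool, 1 / 2 * f (x r) * ∏ e ∈ T.edgeFinset,
          (bern θ (differ x e) * if e ∈ F then g e (differ x e) else 1) :=
        Finset.sum_congr rfl fun x _ => by
          rw [density, hrestrict, Finset.prod_mul_distrib]
          ring
    _ = 1 / 2 * (∑ b, f b) * ∏ e ∈ T.edgeFinset,
          ∑ b, (bern θ b * if e ∈ F then g e b else 1) := by
        rw [sum_root_mul_prod_differ hT r (fun b => 1 / 2 * f b)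
          fun e b => bern θ b * if e ∈ F then g e b else 1, Finset.mul_sum]
    _ = 1 / 2 * (∑ b, f b) * ∏ e ∈ F, ∑ b, bern θ b * g e b := by
        rw [hrestrict]
        congr! 2 with e
        split_ifs <;> simp [bern]

end Density

section Marginal

variable {V α : Type*} [MeasurableSpace α] {P : Measure (V → α)}

/-- The mass function of the marginal of `P` on the coordinates in `S`, as a function of a full
labelling `x` of which only the values on `S` matter. -/
noncomputable def marginal (P : Measure (V → α)) (S : Set V) (x : V → α) : ℝ :=
  P.real {y | ∀ j ∈ S, y j = x j}

theorem marginal_congr {S : Set V} {x y : V → α} (h : ∀ j ∈ S, x j = y j) :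
    marginal P S x = marginal P S y := by
  unfold marginal
  congr! 5 with z j hj
  rw [h j hj]

theorem marginal_update [DecidableEq V] {S : Set V} {i : V} (hi : i ∉ S) (x : V → α) (a : α) :
    marginal P S (Function.update x i a) = marginal P S x :=
  marginal_congr fun _ hj => Function.update_of_ne (ne_of_mem_of_not_mem hj hi) _ _

theorem marginal_anti [IsFiniteMeasure P] {R S : Set V} (h : R ⊆ S) (x : V → α) :
    marginal P S x ≤ marginal P R x :=
  measureReal_mono fun _ hy j hj => hy j (h hj)

@[simp]
theorem marginal_empty [IsProbabilityMeasure P] (x : V → α) : marginal P ∅ x = 1 := by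
  simp [marginal]

@[simp]
theorem marginal_univ (x : V → α) : marginal P Set.univ x = P.real {x} := by
  unfold marginal
  congr 1
  ext y
  simp [funext_iff]

theorem marginal_insert (i : V) (S : Set V) (x : V → α) :
    marginal P (insert i S) x = P.real ({y | ∀ j ∈ S, y j = x j} ∩ {y | y i = x i}) := by
  unfold marginal
  congr 1
  ext y
  simp [and_comm]

theorem marginal_eq_sum [Fintype α] [MeasurableSingletonClass α] [DecidableEq V] [Finite V]
    [IsFiniteMeasure P] {S : Set V} {i : V} (hi : i ∉ S) (x : V → α) :
    marginal P S x = ∑ a, marginal P (insert i S) (Function.update x i a) := by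
  have hfiber : ∀ a, marginal P (insert i S) (Function.update x i a) =
      (P.restrict {y | ∀ j ∈ S, y j = x j}).real ((fun y => y i) ⁻¹' {a}) := fun a => by
    rw [marginal_insert, measureReal_restrict_apply (measurable_pi_apply i (.singleton a)),
      Set.inter_comm, Function.update_self]
    congr! 7 with y j hj
    exact Function.update_of_ne (ne_of_mem_of_not_mem hj hi) _ _
  rw [Finset.sum_congr rfl fun a _ => hfiber a,
    sum_measureReal_preimage_singleton (f := fun y : V → α => y i) _
      fun a _ => measurable_pi_apply i (measurableSet_singleton a)]
  simp [marginal, measureReal_restrict_apply]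

end Marginal

section MarkovOn

variable {V α : Type*} [MeasurableSpace α] {P P' : Measure (V → α)} {T : SimpleGraph V}
  {i : V} {B N S : Set V}

/-- Under `P`, the coordinate `i` is independent of those in `B` given those in `N ⊆ B`. The
conditional probabilities are multiplied out, so that null events need no separate treatment. -/
def CondIndepOn (P : Measure (V → α)) (i : V) (B N : Set V) : Prop :=
  ∀ x, marginal P (insert i B) x * marginal P N x = marginal P B x * marginal P (insert i N) x

/-- The local Markov property with respect to `T` of the marginal of `P` on the coordinates in
`S`. -/
def MarkovOn (T : SimpleGraph V) (P : Measure (V → α)) (S : Set V) : Prop :=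
  ∀ i ∈ S, CondIndepOn P i (S \ {i}) (S ∩ T.neighborSet i)

theorem cond_eq_cond_iff {Ω : Type*} [MeasurableSpace Ω] {μ : Measure Ω} [IsFiniteMeasure μ]
    {A B N : Set Ω} (hB : MeasurableSet B) (hN : MeasurableSet N) (hBN : B ⊆ N) :
    (μ B ≠ 0 → μ[A | B] = μ[A | N]) ↔
      μ.real (B ∩ A) * μ.real N = μ.real B * μ.real (N ∩ A) := by
  rcases eq_or_ne (μ B) 0 with hB0 | hB0
  · have hBA : μ (B ∩ A) = 0 := measure_mono_null Set.inter_subset_left hB0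
    simp [measureReal_def, hB0, hBA]
  have hN0 : μ N ≠ 0 := fun h => hB0 (measure_mono_null hBN h)
  have hB0' : μ.real B ≠ 0 := (measureReal_ne_zero_iff (measure_ne_top μ B)).mpr hB0
  have hN0' : μ.real N ≠ 0 := (measureReal_ne_zero_iff (measure_ne_top μ N)).mpr hN0
  rw [← ENNReal.toReal_eq_toReal_iff' (measure_ne_top _ _) (measure_ne_top _ _),
    cond_apply hB, cond_apply hN, ENNReal.toReal_mul, ENNReal.toReal_mul, ENNReal.toReal_inv,
    ENNReal.toReal_inv]
  simp only [← measureReal_def, ne_eq, hB0, not_false_eq_true, true_implies]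
  rw [inv_mul_eq_div, inv_mul_eq_div, div_eq_div_iff hB0' hN0', mul_comm (μ.real (N ∩ A))]

theorem isMarkov_iff_markovOn_univ {p : ℕ} {T : SimpleGraph (Fin p)}
    {P : Measure (Fin p → Bool)} [IsFiniteMeasure P] :
    IsMarkov T P ↔ MarkovOn T P Set.univ := by
  refine forall_congr' fun i => ?_
  simp only [Set.mem_univ, true_implies]
  refine forall_congr' fun x => ?_
  rw [marginal_insert, marginal_insert]
  unfold marginal
  convert cond_eq_cond_iff (μ := P) (A := {y | y i = x i}) (B := {y | ∀ j, j ≠ i → y j = x j})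
    (N := {y | ∀ j, T.Adj i j → y j = x j}) (.of_discrete) (.of_discrete)
    (fun y hy j hj => hy j hj.ne') using 2 <;> simp

variable [Finite V] [Finite α] [MeasurableSingletonClass α]

theorem CondIndepOn.diff_singleton [IsFiniteMeasure P] (h : CondIndepOn P i B N) {k : V}
    (hkN : k ∉ N) (hki : k ≠ i) : CondIndepOn P i (B \ {k}) N := by
  classical
  cases nonempty_fintype α
  by_cases hkB : k ∈ B
  · intro x
    have hk : k ∉ B \ {k} := fun h => h.2 rfl
    rw [marginal_eq_sum (i := k) (S := insert i (B \ {k})) (by simp [hki]),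
      marginal_eq_sum (i := k) (S := B \ {k}) hk, Set.insert_comm, Set.insert_sdiff_singleton,
      Set.insert_eq_of_mem hkB, Finset.sum_mul, Finset.sum_mul]
    refine Finset.sum_congr rfl fun a _ => ?_
    have := h (Function.update x k a)
    rwa [marginal_update hkN, marginal_update (S := insert i N) (by simp [hkN, hki])] at this
  · rwa [Set.sdiff_singleton_eq_self hkB]

theorem CondIndepOn.mono [IsFiniteMeasure P] (h : CondIndepOn P i B N) {B' : Set V} (hN : N ⊆ B')
    (hB : B' ⊆ B) (hi : i ∉ B) : CondIndepOn P i B' N := by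
  suffices ∀ F : Set V, F ⊆ B \ B' → CondIndepOn P i (B \ F) N by
    simpa [Set.inter_eq_right.mpr hB] using this (B \ B') subset_rfl
  intro F hF
  induction F, F.toFinite using Set.Finite.induction_on with
  | empty => simpa using h
  | @insert k F _ _ ih =>
    obtain ⟨hk, hF⟩ := Set.insert_subset_iff.mp hF
    rw [← Set.union_singleton, ← Set.sdiff_sdiff]
    exact (ih hF).diff_singleton (fun h => hk.2 (hN h)) (ne_of_mem_of_not_mem hk.1 hi)

theorem CondIndepOn.of_insert [IsFiniteMeasure P] {l : V}
    (h : CondIndepOn P i (insert l B) (insert l N)) (hl : CondIndepOn P l (insert i B) {i})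
    (hpos : ∀ x, 0 < marginal P {l, i} x) (hNB : N ⊆ B) (hlB : l ∉ B) (hli : l ≠ i) :
    CondIndepOn P i B N := by
  classical
  cases nonempty_fintype α
  have hlN : CondIndepOn P l (insert i N) {i} :=
    hl.mono (by simp) (Set.insert_subset_insert hNB) (by simp [hli, hlB])
  have hwithout : ∀ x, marginal P (insert i B) x * marginal P (insert l N) x =
      marginal P (insert l B) x * marginal P (insert i N) x := fun x => by
    have hi := h x
    rw [Set.insert_comm i l, Set.insert_comm i l] at hi
    apply mul_left_cancel₀ (hpos x).ne'
    linear_combination marginal P {i} x * hi - marginal P (insert l N) x * hl x +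
      marginal P (insert l B) x * hlN x
  intro x
  rw [marginal_eq_sum (fun h => hlB (hNB h)) x, marginal_eq_sum hlB x, Finset.mul_sum,
    Finset.sum_mul]
  refine Finset.sum_congr rfl fun a _ => ?_
  have := hwithout (Function.update x l a)
  rwa [marginal_update (S := insert i B) (by grind),
    marginal_update (S := insert i N) (by grind)] at this

theorem MarkovOn.diff_leaf [IsFiniteMeasure P] (hm : MarkovOn T P S) {l : V} (hl : l ∈ S)
    (hleaf : (S ∩ T.neighborSet l).Subsingleton)
    (hpos : ∀ i ∈ S, T.Adj l i → ∀ x, 0 < marginal P {l, i} x) : MarkovOn T P (S \ {l}) := by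
  rintro i ⟨hiS, hil : i ≠ l⟩
  by_cases hadj : T.Adj l i
  · have hN : S ∩ T.neighborSet l = {i} := hleaf.eq_singleton_of_mem ⟨hiS, hadj⟩
    have hBS : S \ {i} = insert l ((S \ {l}) \ {i}) := by grind
    have hNS : S ∩ T.neighborSet i = insert l (S \ {l} ∩ T.neighborSet i) := by
      ext j
      by_cases hj : j = l
      · simp [hj, hl, hadj.symm]
      · simp [hj]
    refine CondIndepOn.of_insert (hNS ▸ hBS ▸ hm i hiS) ?_ (hpos i hiS hadj)
      (fun j hj => ⟨hj.1, (T.ne_of_adj hj.2).symm⟩) (fun h => h.1.2 rfl) hil.symm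
    rw [Set.insert_sdiff_singleton, Set.insert_eq_of_mem (show i ∈ S \ {l} from ⟨hiS, hil⟩), ← hN]
    exact hm l hl
  · have hB : (S \ {l}) \ {i} = (S \ {i}) \ {l} := by grind
    have hN : S \ {l} ∩ T.neighborSet i = S ∩ T.neighborSet i := by
      rw [Set.sdiff_inter_right_comm]
      exact Set.sdiff_singleton_eq_self fun h => hadj h.2.symm
    rw [hB, hN]
    exact (hm i hiS).diff_singleton (fun h => hadj h.2.symm) hil.symm

theorem MarkovOn.marginal_eq [IsProbabilityMeasure P] [IsProbabilityMeasure P'] (hT : T.IsTree)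
    (hP : MarkovOn T P S) (hP' : MarkovOn T P' S)
    (hpos : ∀ i j, T.Adj i j → ∀ x, 0 < marginal P {i, j} x)
    (hsingle : ∀ i x, marginal P {i} x = marginal P' {i} x)
    (hpair : ∀ i j, T.Adj i j → ∀ x, marginal P {i, j} x = marginal P' {i, j} x) (x : V → α) :
    marginal P S x = marginal P' S x := by
  induction hn : S.ncard using Nat.strong_induction_on generalizing S with
  | _ n ih =>
    rcases S.eq_empty_or_nonempty with rfl | hS
    · simp
    obtain ⟨l, hl, hleaf⟩ := exists_mem_subsingleton_neighbors hT S.toFinite hS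
    have hrest : marginal P (S \ {l}) x = marginal P' (S \ {l}) x :=
      ih _ (hn ▸ Set.ncard_sdiff_singleton_lt_of_mem hl)
        (hP.diff_leaf hl hleaf fun i _ hi => hpos l i hi)
        (hP'.diff_leaf hl hleaf fun i _ hi x => hpair l i hi x ▸ hpos l i hi x) rfl
    have hCI := hP l hl x
    have hCI' := hP' l hl x
    rw [Set.insert_sdiff_singleton, Set.insert_eq_of_mem hl] at hCI hCI'
    obtain hN | ⟨a, hN⟩ := hleaf.eq_empty_or_singleton
    · simp only [hN, marginal_empty, mul_one, insert_empty_eq] at hCI hCI'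
      rw [hCI, hCI', hrest, hsingle]
    · have hla : T.Adj l a := ((Set.ext_iff.mp hN a).mpr rfl).2
      rw [hN] at hCI hCI'
      have ha : 0 < marginal P {a} x := (hpos l a hla x).trans_le (marginal_anti (by simp) x)
      apply mul_right_cancel₀ ha.ne'
      rw [hCI, hrest, hpair l a hla, hsingle, hCI']

theorem exists_marginal_insert_eq_mul [DecidableEq V] [IsFiniteMeasure P] {a b : (V → α) → ℝ}
    (hab : ∀ x, P.real {x} = b x * a x) (ha : ∀ x s, a (Function.update x i s) = a x)
    (hb : ∀ x, ∀ k ∉ insert i N, ∀ s, b (Function.update x k s) = b x) (hNB : N ⊆ B) :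
    ∃ c : (V → α) → ℝ, (∀ x s, c (Function.update x i s) = c x) ∧
      ∀ x, marginal P (insert i B) x = b x * c x := by
  cases nonempty_fintype α
  suffices ∀ F : Set V, F ⊆ (insert i B)ᶜ → ∃ c : (V → α) → ℝ,
      (∀ x s, c (Function.update x i s) = c x) ∧ ∀ x, marginal P Fᶜ x = b x * c x by
    simpa using this _ subset_rfl
  intro F hF
  induction F, F.toFinite using Set.Finite.induction_on with
  | empty => exact ⟨a, ha, by simpa using hab⟩
  | @insert k F hkF _ ih =>
    obtain ⟨hk, hF⟩ := Set.insert_subset_iff.mp hF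
    obtain ⟨c, hc, hcF⟩ := ih hF
    have hki : k ≠ i := fun h => hk (Or.inl h)
    refine ⟨fun x => ∑ t, c (Function.update x k t), fun x s => ?_, fun x => ?_⟩
    · simp only [Function.update_comm hki.symm, hc]
    · have hcompl : insert k (insert k F)ᶜ = Fᶜ := by grind
      rw [marginal_eq_sum (i := k) (by simp), hcompl, Finset.mul_sum]
      refine Finset.sum_congr rfl fun t _ => ?_
      rw [hcF, hb x k (fun h => hk (Set.insert_subset_insert hNB h))]

theorem condIndepOn_of_real_singleton_eq_mul [DecidableEq V] [IsFiniteMeasure P]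
    {a b : (V → α) → ℝ} (hab : ∀ x, P.real {x} = b x * a x)
    (ha : ∀ x s, a (Function.update x i s) = a x)
    (hb : ∀ x, ∀ k ∉ insert i N, ∀ s, b (Function.update x k s) = b x) (hNB : N ⊆ B)
    (hi : i ∉ B) : CondIndepOn P i B N := by
  cases nonempty_fintype α
  obtain ⟨c, hc, hcB⟩ := exists_marginal_insert_eq_mul hab ha hb hNB
  obtain ⟨d, hd, hdN⟩ := exists_marginal_insert_eq_mul hab ha hb subset_rfl
  intro x
  rw [marginal_eq_sum hi, marginal_eq_sum fun h => hi (hNB h)]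
  simp only [hcB, hdN, hc, hd, ← Finset.sum_mul]
  ring

end MarkovOn

section TreeModel

theorem measureReal_setOf_eq_sum {Ω : Type*} [Fintype Ω] [MeasurableSpace Ω]
    [MeasurableSingletonClass Ω] (μ : Measure Ω) [IsFiniteMeasure μ] (A : Ω → Prop)
    [DecidablePred A] : μ.real {ω | A ω} = ∑ ω, μ.real {ω} * if A ω then 1 else 0 := by
  simp only [mul_ite, mul_one, mul_zero, ← Finset.sum_filter, sum_measureReal_singleton,
    Finset.coe_filter_univ]

variable {V : Type*} [Finite V] {θ : ℝ} {T : SimpleGraph V} [Fintype T.edgeSet]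

theorem markovOn_univ_of_density {P : Measure (V → Bool)} [IsFiniteMeasure P]
    (hP : ∀ x, P.real {x} = density θ T x) : MarkovOn T P Set.univ := by
  classical
  intro i _
  refine condIndepOn_of_real_singleton_eq_mul
    (a := fun x => 1 / 2 * ∏ e ∈ T.edgeFinset with i ∉ e, bern θ (differ x e))
    (b := fun x => ∏ e ∈ T.edgeFinset with i ∈ e, bern θ (differ x e)) (fun x => ?_)
    (fun x s => ?_) (fun x k hk s => ?_) (fun j hj => ⟨hj.1, (T.ne_of_adj hj.2).symm⟩)
    (fun h => h.2 rfl)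
  · rw [hP, density, ← Finset.prod_filter_mul_prod_filter_not T.edgeFinset (i ∈ ·)]
    ring
  · refine congrArg _ (Finset.prod_congr rfl fun e he => congrArg _ (differ_congr fun j hj => ?_))
    exact Function.update_of_ne (ne_of_mem_of_not_mem hj (Finset.mem_filter.mp he).2) _ _
  · refine Finset.prod_congr rfl fun e he => congrArg _ (differ_congr fun j hj => ?_)
    refine Function.update_of_ne (fun hjk => hk ?_) _ _
    obtain ⟨he, a, rfl⟩ := Finset.mem_filter.mp he
    rcases Sym2.mem_iff.mp hj with rfl | rfl
    · exact Or.inl hjk.symm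
    · exact Or.inr ⟨trivial, hjk ▸ by simpa using he⟩

theorem exists_real_singleton_eq_density (hT : T.IsTree) (h0 : 0 < θ) (h1 : θ < 1) :
    ∃ P : Measure (V → Bool), IsProbabilityMeasure P ∧ ∀ x, P.real {x} = density θ T x := by
  classical
  cases nonempty_fintype V
  obtain ⟨r⟩ := hT.connected.nonempty
  have hsum : ∑ x, density θ T x = 1 := by
    simpa using sum_density_mul hT θ r (fun _ => 1) (Finset.empty_subset _) fun _ _ => 1
  have hsum' : ∑ x, ENNReal.ofReal (density θ T x) = 1 := by
    rw [← ENNReal.ofReal_sum_of_nonneg fun x _ => (density_pos h0 h1 T x).le, hsum,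
      ENNReal.ofReal_one]
  refine ⟨(PMF.ofFintype _ hsum').toMeasure, inferInstance, fun x => ?_⟩
  rw [measureReal_def, PMF.toMeasure_apply_singleton _ _ (measurableSet_singleton x),
    PMF.ofFintype_apply, ENNReal.toReal_ofReal (density_pos h0 h1 T x).le]

theorem measureReal_and_differ_eq {P : Measure (V → Bool)} [IsFiniteMeasure P] (hT : T.IsTree)
    (hP : ∀ x, P.real {x} = density θ T x) {i : V} {e : Sym2 V} (he : e ∈ T.edgeSet) (b c : Bool) :
    P.real {x | x i = b ∧ differ x e = c} = 1 / 2 * bern θ c := by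
  classical
  cases nonempty_fintype V
  rw [measureReal_setOf_eq_sum]
  have := sum_density_mul hT θ i (fun b' => if b' = b then 1 else 0)
    (Finset.singleton_subset_iff.mpr (SimpleGraph.mem_edgeFinset.mpr he))
    fun _ c' => if c' = c then 1 else 0
  simpa [hP, ← ite_and, and_comm] using this

theorem measureReal_eq_half {P : Measure (V → Bool)} [IsFiniteMeasure P] (hT : T.IsTree)
    (hP : ∀ x, P.real {x} = density θ T x) (i : V) (b : Bool) :
    P.real {x | x i = b} = 1 / 2 := by
  classical
  cases nonempty_fintype V
  rw [measureReal_setOf_eq_sum]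
  have := sum_density_mul hT θ i (fun b' => if b' = b then 1 else 0) (Finset.empty_subset _)
    fun _ _ => 1
  simpa [hP] using this

variable {p : ℕ} {T : SimpleGraph (Fin p)} {P : Measure (Fin p → Bool)}

theorem isTreeModel_of_density [Fintype T.edgeSet] [IsProbabilityMeasure P] (hT : T.IsTree)
    (hP : ∀ x, P.real {x} = density θ T x) : IsTreeModel θ T P where
  isTree := hT
  isProbabilityMeasure := inferInstance
  isMarkov := isMarkov_iff_markovOn_univ.mpr (markovOn_univ_of_density hP)
  uniform := measureReal_eq_half hT hP
  homogeneous i j hij := by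
    have hflip : ∀ b, P.real {x | x i = b ∧ x j = !b} = θ / 2 := fun b => by
      have hiff : ∀ x : Fin p → Bool, x i = b ∧ x j = !b ↔ x i = b ∧ differ x s(i, j) = true := by
        intro x
        cases hi : x i <;> cases hj : x j <;> cases b <;> simp [hi, hj]
      simp only [hiff, measureReal_and_differ_eq hT hP (T.mem_edgeSet.mpr hij)]
      rw [bern, if_pos rfl]
      ring
    exact ⟨hflip false, hflip true⟩

theorem IsTreeModel.marginal_singleton (hP : IsTreeModel θ T P) (i : Fin p) (x : Fin p → Bool) :
    marginal P {i} x = 1 / 2 := by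
  simpa [marginal] using hP.uniform i (x i)

theorem IsTreeModel.marginal_pair (hP : IsTreeModel θ T P) {i j : Fin p} (hij : T.Adj i j)
    (x : Fin p → Bool) : marginal P {i, j} x = 1 / 2 * bern θ (differ x s(i, j)) := by
  have := hP.isProbabilityMeasure
  have hne : ∀ a b, a ≠ b → P.real {x | x i = a ∧ x j = b} = θ / 2 := fun a b hab => by
    obtain ⟨hft, htf⟩ := hP.homogeneous i j hij
    cases a <;> cases b <;> first | exact absurd rfl hab | assumption
  have hsum : ∀ a, P.real {x | x i = a ∧ x j = true} + P.real {x | x i = a ∧ x j = false} =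
      1 / 2 := fun a => by
    rw [← hP.marginal_singleton i fun _ => a, marginal_eq_sum (i := j) (by simpa using hij.ne'),
      Set.pair_comm, Fintype.sum_bool]
    simp [marginal, Function.update_of_ne hij.ne]
  suffices ∀ a b, P.real {x | x i = a ∧ x j = b} = 1 / 2 * bern θ (xor a b) by
    simpa [marginal] using this (x i) (x j)
  intro a b
  have hsum_a := hsum a
  have hne_a := hne a !a
  cases a <;> cases b <;> simp [bern] at hne_a ⊢ <;> linarith

theorem IsTreeModel.real_singleton [Fintype T.edgeSet] (hP : IsTreeModel θ T P) (h0 : 0 < θ)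
    (h1 : θ < 1) (x : Fin p → Bool) : P.real {x} = density θ T x := by
  have := hP.isProbabilityMeasure
  obtain ⟨Q, _, hQ⟩ := exists_real_singleton_eq_density hP.isTree h0 h1
  have hQ' := isTreeModel_of_density hP.isTree hQ
  rw [← hQ, ← marginal_univ, ← marginal_univ]
  refine (isMarkov_iff_markovOn_univ.mp hP.isMarkov).marginal_eq hP.isTree
    (isMarkov_iff_markovOn_univ.mp hQ'.isMarkov) (fun i j hij x => ?_)
    (fun i x => ?_) (fun i j hij x => ?_) x
  · rw [hP.marginal_pair hij]
    exact mul_pos (by norm_num) (bern_pos h0 h1 _)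
  · rw [hP.marginal_singleton, hQ'.marginal_singleton]
  · rw [hP.marginal_pair hij, hQ'.marginal_pair hij]

end TreeModel

section Likelihood

variable {n : ℕ}

/-- The number of samples among `x` that take different values at the two ends of `e`. -/
def disagreements {V : Type*} (x : Fin n → V → Bool) (e : Sym2 V) : ℕ :=
  ∑ k, (differ (x k) e).toNat

theorem log_bern (θ : ℝ) (b : Bool) :
    Real.log (bern θ b) = Real.log (1 - θ) - b.toNat * (Real.log (1 - θ) - Real.log θ) := by
  cases b <;> simp [bern]

theorem log_density {V : Type*} {θ : ℝ} {T : SimpleGraph V} [Fintype T.edgeSet] (h0 : 0 < θ)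
    (h1 : θ < 1) (x : V → Bool) :
    Real.log (density θ T x) = Real.log (1 / 2) + T.edgeFinset.card * Real.log (1 - θ) -
      (∑ e ∈ T.edgeFinset, ((differ x e).toNat : ℝ)) * (Real.log (1 - θ) - Real.log θ) := by
  have hne : ∀ e ∈ T.edgeFinset, bern θ (differ x e) ≠ 0 := fun e _ => (bern_pos h0 h1 _).ne'
  rw [density, Real.log_mul (by norm_num) (Finset.prod_ne_zero_iff.mpr hne), Real.log_prod hne]
  simp only [log_bern, Finset.sum_sub_distrib, Finset.sum_const, nsmul_eq_mul, ← Finset.sum_mul]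
  ring

variable {p : ℕ} {θ : ℝ} {T : SimpleGraph (Fin p)} {Q : Measure (Fin p → Bool)}
  {x : Fin n → Fin p → Bool}

theorem IsTreeModel.logLikelihood_eq [Fintype T.edgeSet] (hQ : IsTreeModel θ T Q) (h0 : 0 < θ)
    (h1 : θ < 1) (x : Fin n → Fin p → Bool) :
    logLikelihood x Q = n * (Real.log (1 / 2) + T.edgeFinset.card * Real.log (1 - θ)) -
      (∑ e ∈ T.edgeFinset, disagreements x e : ℕ) * (Real.log (1 - θ) - Real.log θ) := by
  simp only [logLikelihood, hQ.real_singleton h0 h1, log_density h0 h1, disagreements,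
    Finset.sum_sub_distrib, Finset.sum_const, Finset.card_univ, Fintype.card_fin, nsmul_eq_mul,
    ← Finset.sum_mul, Nat.cast_sum]
  rw [Finset.sum_comm]

theorem IsMLEstimate.sum_disagreements_le (hML : IsMLEstimate θ x Q) (h0 : 0 < θ)
    (h1 : θ < 1 / 2) (hQ : IsTreeModel θ T Q) {T' : SimpleGraph (Fin p)} (hT' : T'.IsTree)
    [Fintype T.edgeSet] [Fintype T'.edgeSet] :
    ∑ e ∈ T.edgeFinset, disagreements x e ≤ ∑ e ∈ T'.edgeFinset, disagreements x e := by
  have h1' : θ < 1 := by linarith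
  obtain ⟨Q', _, hdensity⟩ := exists_real_singleton_eq_density hT' h0 h1'
  have hQ' := isTreeModel_of_density hT' hdensity
  have hlik : logLikelihood x Q' ≤ logLikelihood x Q := hML.2 ⟨T', hQ'⟩
  have hcard : T'.edgeFinset.card = T.edgeFinset.card :=
    Nat.add_right_cancel (hT'.card_edgeFinset.trans hQ.isTree.card_edgeFinset.symm)
  rw [hQ.logLikelihood_eq h0 h1', hQ'.logLikelihood_eq h0 h1', hcard] at hlik
  have hlog : 0 < Real.log (1 - θ) - Real.log θ :=
    sub_pos.mpr (Real.log_lt_log h0 (by linarith))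
  exact_mod_cast le_of_mul_le_mul_right (sub_le_sub_iff_left _ |>.mp hlik) hlog

theorem IsMLEstimate.disagreements_le (hML : IsMLEstimate θ x Q) (h0 : 0 < θ) (h1 : θ < 1 / 2)
    (hQ : IsTreeModel θ T Q) {e : Sym2 (Fin p)} (he : e ∈ T.edgeSet) {i j : Fin p}
    (hij : ¬(T.deleteEdges {e}).Reachable i j) :
    disagreements x e ≤ disagreements x s(i, j) := by
  classical
  have hexchange := sum_edgeFinset_exchange he hij (disagreements x)
  have hle := hML.sum_disagreements_le h0 h1 hQ (isTree_deleteEdges_sup_edge hQ.isTree he hij)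
  omega

theorem IsMLEstimate.exists_crossover (hML : IsMLEstimate θ x Q) (h0 : 0 < θ) (h1 : θ < 1 / 2)
    {T' : SimpleGraph (Fin p)} (hQ : IsTreeModel θ T' Q) (hT : T.IsTree) (hne : T' ≠ T) :
    ∃ q ∈ crossoverPairs T, disagreements x q.1 ≤ disagreements x q.2 := by
  obtain ⟨i, j, hij, hnij⟩ := exists_adj_not_adj hT hQ.isTree hne
  obtain ⟨w, hw⟩ := hT.connected.exists_isPath i j
  obtain ⟨a, b, hab, hreach⟩ := exists_mem_edges_not_reachable w
    (not_reachable_deleteEdges hQ.isTree.isAcyclic hij)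
  exact ⟨(s(i, j), s(a, b)), ⟨i, j, w, hw, hnij, rfl, hab⟩,
    hML.disagreements_le h0 h1 hQ hij hreach⟩

theorem IsMLEstimate.ne_of_disagreements_lt (hML : IsMLEstimate θ x Q) (h0 : 0 < θ)
    (h1 : θ < 1 / 2) {T' : SimpleGraph (Fin p)} (hQ : IsTreeModel θ T' Q) {a i j : Fin p}
    (hai : T.Adj a i) (haj : T.Adj a j) (hij : i ≠ j)
    (hlt : disagreements x s(i, j) < disagreements x s(a, i)) : T' ≠ T := by
  rintro rfl
  refine hlt.not_ge (hML.disagreements_le h0 h1 hQ hai fun hreach => ?_)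
  have haj' : (T'.deleteEdges {s(a, i)}).Adj a j := by
    simp [SimpleGraph.deleteEdges_adj, haj, hij.symm, haj.ne']
  exact not_reachable_deleteEdges hQ.isTree.isAcyclic hai (haj'.reachable.trans hreach.symm)

end Likelihood

section NonnegCoeff

open Polynomial

variable {f g : ℝ[X]}

theorem coeff_mul_coeff_le_coeff_mul (hf : ∀ s, 0 ≤ f.coeff s) (hg : ∀ s, 0 ≤ g.coeff s)
    (i j : ℕ) : f.coeff i * g.coeff j ≤ (f * g).coeff (i + j) := by
  rw [coeff_mul]
  exact Finset.single_le_sum (f := fun ab : ℕ × ℕ => f.coeff ab.1 * g.coeff ab.2)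
    (fun ab _ => mul_nonneg (hf _) (hg _))
    (Finset.HasAntidiagonal.mem_antidiagonal.mpr rfl : (i, j) ∈ _)

theorem coeff_pow_nonneg (hf : ∀ s, 0 ≤ f.coeff s) (n s : ℕ) : 0 ≤ (f ^ n).coeff s := by
  induction n generalizing s with
  | zero =>
    rw [pow_zero, coeff_one]
    split_ifs <;> norm_num
  | succ n ih =>
    rw [pow_succ, coeff_mul]
    exact Finset.sum_nonneg fun ab _ => mul_nonneg (ih _) (hf _)

theorem coeff_pow_mul_coeff_le (hf : ∀ s, 0 ≤ f.coeff s) (n i j : ℕ) :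
    (f ^ n).coeff i * f.coeff j ≤ (f ^ (n + 1)).coeff (i + j) := by
  rw [pow_succ]
  exact coeff_mul_coeff_le_coeff_mul (coeff_pow_nonneg hf n) hf i j

theorem sum_range_coeff_mul_pow_le_eval (hf : ∀ s, 0 ≤ f.coeff s) {t : ℝ} (ht0 : 0 ≤ t)
    (ht1 : t ≤ 1) (n : ℕ) : (∑ s ∈ Finset.range (n + 1), f.coeff s) * t ^ n ≤ f.eval t := by
  have hnat : f.natDegree < max (n + 1) (f.natDegree + 1) :=
    (Nat.lt_succ_self _).trans_le (le_max_right _ _)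
  rw [eval_eq_sum_range' hnat, Finset.sum_mul]
  calc ∑ s ∈ Finset.range (n + 1), f.coeff s * t ^ n
      ≤ ∑ s ∈ Finset.range (n + 1), f.coeff s * t ^ s := by
        refine Finset.sum_le_sum fun s hs => mul_le_mul_of_nonneg_left ?_ (hf s)
        exact pow_le_pow_of_le_one ht0 ht1 (Finset.mem_range_succ_iff.mp hs)
    _ ≤ _ := Finset.sum_le_sum_of_subset_of_nonneg
        (Finset.range_subset_range.mpr (le_max_left _ _))
        fun s _ _ => mul_nonneg (hf s) (pow_nonneg ht0 s)

end NonnegCoeff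

section CentralCoeff

open Polynomial

theorem reflect_pow_eq_self {R : Type*} [CommSemiring R] {f : R[X]} {d : ℕ}
    (hd : f.natDegree ≤ d) (hf : reflect d f = f) (m : ℕ) : reflect (d * m) (f ^ m) = f ^ m := by
  induction m with
  | zero => simp
  | succ m ih =>
    have hdm : (f ^ m).natDegree ≤ d * m := mul_comm d m ▸ natDegree_pow_le_of_le m hd
    rw [pow_succ, Nat.mul_succ, reflect_mul _ _ hdm hd, ih, hf]

-- For a palindromic `f` the middle coefficient of `f * f` is the sum of the squares of the
-- coefficients of `f`, so this is the Cauchy-Schwarz inequality.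
theorem eval_one_sq_le_coeff_mul_self {f : ℝ[X]} {d : ℕ} (hd : f.natDegree ≤ d)
    (hf : reflect d f = f) : f.eval 1 ^ 2 ≤ (d + 1) * (f * f).coeff d := by
  have hmiddle : (f * f).coeff d = ∑ i ∈ Finset.range (d + 1), f.coeff i ^ 2 := by
    rw [coeff_mul, Finset.Nat.sum_antidiagonal_eq_sum_range_succ fun i j => f.coeff i * f.coeff j]
    refine Finset.sum_congr rfl fun i hi => ?_
    have hsymm := congrArg (fun g => g.coeff i) hf
    simp only [coeff_reflect, revAt_le (Finset.mem_range_succ_iff.mp hi)] at hsymm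
    rw [hsymm, sq]
  have hsum : f.eval 1 = ∑ i ∈ Finset.range (d + 1), f.coeff i := by
    simpa using eval_eq_sum_range' (Nat.lt_succ_of_le hd) (1 : ℝ)
  rw [hmiddle, hsum]
  simpa using sq_sum_le_card_mul_sum_sq (s := Finset.range (d + 1)) (f := fun i => f.coeff i)

theorem le_coeff_pow_of_palindromic (a c : ℝ) (m : ℕ) :
    (c + 2 * a) ^ (2 * m) / (2 * m + 1) ≤
      ((C a + C c * X + C a * X ^ 2) ^ (2 * m) : ℝ[X]).coeff (2 * m) := by
  set f : ℝ[X] := C a + C c * X + C a * X ^ 2 with hf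
  have hd : f.natDegree ≤ 2 := by rw [hf]; compute_degree
  have hrefl : reflect 2 f = f := by
    ext k
    rw [coeff_reflect]
    by_cases hk : k ≤ 2
    · rw [revAt_le hk]
      interval_cases k <;> simp [hf, coeff_X, coeff_C, coeff_X_pow]
    · rw [revAt_eq_self_of_lt (by omega)]
  have heval : f.eval 1 = c + 2 * a := by
    simp only [hf, eval_add, eval_mul, eval_C, eval_X, eval_pow]
    ring
  have hdm : (f ^ m).natDegree ≤ 2 * m := mul_comm 2 m ▸ natDegree_pow_le_of_le m hd
  have hcs := eval_one_sq_le_coeff_mul_self hdm (reflect_pow_eq_self hd hrefl m)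
  rw [eval_pow, heval, ← pow_mul, ← pow_add, ← two_mul, mul_comm m 2] at hcs
  rw [div_le_iff₀' (by positivity)]
  exact_mod_cast hcs

-- The substitution `X ↦ √v / √u * X` makes the quadratic palindromic up to a constant factor.
theorem le_coeff_pow_two_mul {u v : ℝ} (hu : 0 < u) (hv : 0 < v) (c : ℝ) (m : ℕ) :
    (c + 2 * (√u * √v)) ^ (2 * m) / (2 * m + 1) ≤
      ((C v + C c * X + C u * X ^ 2) ^ (2 * m) : ℝ[X]).coeff (2 * m) := by
  refine (le_coeff_pow_of_palindromic (√u * √v) c m).trans_eq ?_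
  have hsu : 0 < √u := Real.sqrt_pos.mpr hu
  have hsv : 0 < √v := Real.sqrt_pos.mpr hv
  have hu' : √u ^ 2 = u := Real.sq_sqrt hu.le
  have hv' : √v ^ 2 = v := Real.sq_sqrt hv.le
  set t := √v / √u with ht
  have hcomp : (C v + C c * X + C u * X ^ 2 : ℝ[X]).comp (C t * X) =
      C t * (C (√u * √v) + C c * X + C (√u * √v) * X ^ 2) := by
    have hconst : v = t * (√u * √v) := by
      rw [ht]
      field_simp
      exact hv'.symm
    have hlead : u * t ^ 2 = t * (√u * √v) := by
      rw [ht]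
      field_simp
      exact hu'.symm
    have hconst' := congrArg (C : ℝ → ℝ[X]) hconst
    have hlead' := congrArg (C : ℝ → ℝ[X]) hlead
    simp only [C_mul, C_pow] at hconst' hlead'
    simp only [add_comp, mul_comp, C_comp, X_comp, pow_comp, C_mul]
    linear_combination hconst' + X ^ 2 * hlead'
  have hcoeff := congrArg (fun f => (f ^ (2 * m)).coeff (2 * m)) hcomp
  simp only [← pow_comp, mul_pow, ← C_pow, coeff_C_mul, comp_C_mul_X_coeff] at hcoeff
  rw [mul_comm] at hcoeff
  exact (mul_left_cancel₀ (pow_pos (div_pos hsv hsu) _).ne' hcoeff).symm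

end CentralCoeff

section LazyWalk

open Polynomial

/-- The `ρ` for which `ρ ^ n`, up to polynomial factors, is the probability that a random walk on
`ℤ`, which moves up with probability `u`, down with probability `v ≤ u` and stays otherwise, is at
or below its start after `n` steps. -/
noncomputable def crossoverBase (u v : ℝ) : ℝ := 1 - (√u - √v) ^ 2

theorem crossoverBase_eq {u v : ℝ} (hu : 0 ≤ u) (hv : 0 ≤ v) :
    crossoverBase u v = 1 - u - v + 2 * (√u * √v) := by
  rw [crossoverBase]
  linear_combination -Real.sq_sqrt hu - Real.sq_sqrt hv

theorem crossoverBase_le_one (u v : ℝ) : crossoverBase u v ≤ 1 :=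
  sub_le_self 1 (sq_nonneg _)

theorem crossoverBase_nonneg {u v : ℝ} (hu : 0 ≤ u) (hv : 0 ≤ v) (huv : u + v ≤ 1) :
    0 ≤ crossoverBase u v := by
  rw [crossoverBase_eq hu hv]
  have := mul_nonneg (Real.sqrt_nonneg u) (Real.sqrt_nonneg v)
  linarith

/-- The generating polynomial of `1 + Z`, where `Z` is `1` with probability `u`, `-1` with
probability `v` and `0` otherwise. -/
noncomputable def lazyPoly (u v : ℝ) : ℝ[X] := C v + C (1 - u - v) * X + C u * X ^ 2

variable {u v : ℝ}

theorem coeff_lazyPoly (u v : ℝ) (s : ℕ) : (lazyPoly u v).coeff s =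
    if s = 0 then v else if s = 1 then 1 - u - v else if s = 2 then u else 0 := by
  simp only [lazyPoly, coeff_add, coeff_C, coeff_C_mul, coeff_X, coeff_X_pow]
  split_ifs <;> first | omega | simp

theorem coeff_lazyPoly_nonneg (hu : 0 ≤ u) (hv : 0 ≤ v) (huv : u + v ≤ 1) (s : ℕ) :
    0 ≤ (lazyPoly u v).coeff s := by
  rw [coeff_lazyPoly]
  split_ifs <;> linarith

theorem eval_lazyPoly (hu : 0 < u) (hv : 0 ≤ v) :
    (lazyPoly u v).eval (√v / √u) = crossoverBase u v * (√v / √u) := by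
  have hsu : √u ≠ 0 := (Real.sqrt_pos.mpr hu).ne'
  have hu' : √u ^ 2 = u := Real.sq_sqrt hu.le
  have hv' : √v ^ 2 = v := Real.sq_sqrt hv
  simp only [lazyPoly, eval_add, eval_mul, eval_C, eval_X, eval_pow]
  rw [crossoverBase_eq hu.le hv]
  field_simp [hsu]
  linear_combination (v - 2 * √v ^ 2) * hu' - u * hv'

theorem sum_range_coeff_lazyPoly_pow_le (hv : 0 < v) (hvu : v ≤ u) (huv : u + v ≤ 1) (n : ℕ) :
    ∑ s ∈ Finset.range (n + 1), (lazyPoly u v ^ n).coeff s ≤ crossoverBase u v ^ n := by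
  have hu : 0 < u := hv.trans_le hvu
  have ht : 0 < √v / √u := div_pos (Real.sqrt_pos.mpr hv) (Real.sqrt_pos.mpr hu)
  have hchernoff := sum_range_coeff_mul_pow_le_eval
    (coeff_pow_nonneg (coeff_lazyPoly_nonneg hu.le hv.le huv) n) ht.le
    (div_le_one_of_le₀ (Real.sqrt_le_sqrt hvu) (Real.sqrt_nonneg u)) n
  rw [eval_pow, eval_lazyPoly hu hv.le, mul_pow] at hchernoff
  exact le_of_mul_le_mul_right hchernoff (pow_pos ht n)

theorem le_coeff_lazyPoly_pow_self (hu : 0 < u) (hv : 0 < v) (huv : u + v ≤ 1) (n : ℕ) :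
    (1 - u - v) * (crossoverBase u v ^ n / (n + 1)) ≤ (lazyPoly u v ^ n).coeff n := by
  have hbase := crossoverBase_nonneg hu.le hv.le huv
  have hcentral : ∀ m : ℕ, crossoverBase u v ^ (2 * m) / (2 * m + 1) ≤
      (lazyPoly u v ^ (2 * m)).coeff (2 * m) := fun m => by
    rw [crossoverBase_eq hu.le hv.le]
    exact le_coeff_pow_two_mul hu hv _ m
  rcases Nat.even_or_odd' n with ⟨m, rfl | rfl⟩
  · calc _ ≤ 1 * (crossoverBase u v ^ (2 * m) / ((2 * m : ℕ) + 1)) := by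
          gcongr
          linarith
      _ ≤ _ := by simpa using hcentral m
  · calc _ ≤ (1 - u - v) * (crossoverBase u v ^ (2 * m) / (2 * m + 1)) := by
          refine mul_le_mul_of_nonneg_left (div_le_div₀ (by positivity) ?_ (by positivity) ?_)
            (by linarith)
          · exact pow_le_pow_of_le_one hbase (crossoverBase_le_one u v) (Nat.le_succ _)
          · push_cast
            linarith
      _ ≤ (lazyPoly u v ^ (2 * m)).coeff (2 * m) * (lazyPoly u v).coeff 1 := by
          rw [mul_comm, coeff_lazyPoly, if_neg one_ne_zero, if_pos rfl]
          exact mul_le_mul_of_nonneg_right (hcentral m) (by linarith)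
      _ ≤ _ := coeff_pow_mul_coeff_le (coeff_lazyPoly_nonneg hu.le hv.le huv) _ _ _

theorem le_coeff_lazyPoly_pow_succ (hu : 0 < u) (hv : 0 < v) (huv : u + v ≤ 1) (n : ℕ) :
    v * (1 - u - v) * (crossoverBase u v ^ (n + 1) / (n + 1)) ≤
      (lazyPoly u v ^ (n + 1)).coeff n := by
  have hbase := crossoverBase_nonneg hu.le hv.le huv
  calc _ ≤ (1 - u - v) * (crossoverBase u v ^ n / (n + 1)) * v := by
        rw [mul_comm v, mul_right_comm]
        gcongr ?_ * (?_ / _) * _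
        · linarith
        · exact pow_le_pow_of_le_one hbase (crossoverBase_le_one u v) (Nat.le_succ _)
    _ ≤ (lazyPoly u v ^ n).coeff n * (lazyPoly u v).coeff 0 := by
        rw [coeff_lazyPoly, if_pos rfl]
        exact mul_le_mul_of_nonneg_right (le_coeff_lazyPoly_pow_self hu hv huv n) hv.le
    _ ≤ _ := coeff_pow_mul_coeff_le (coeff_lazyPoly_nonneg hu.le hv.le huv) n n 0

variable {Ω : Type*} [MeasurableSpace Ω] {μ : Measure Ω}

theorem measureReal_sum_eq_coeff_pow [IsProbabilityMeasure μ] {Y : ℕ → Ω → ℕ}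
    (hm : ∀ k, AEMeasurable (Y k) μ) (hY : iIndepFun Y μ) {f : ℝ[X]}
    (hf : ∀ k s, μ.real {ω | Y k ω = s} = f.coeff s) (n s : ℕ) :
    μ.real {ω | ∑ k ∈ Finset.range n, Y k ω = s} = (f ^ n).coeff s := by
  induction n generalizing s with
  | zero =>
    by_cases hs : s = 0
    · simp [hs]
    · simp [coeff_one, hs, Ne.symm hs]
  | succ n ih =>
    have hindep : IndepFun (fun ω => ∑ k ∈ Finset.range n, Y k ω) (Y n) μ := by
      simpa only [← Finset.sum_apply] using hY.indepFun_sum_range_succ₀ hm n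
    have hsum : AEMeasurable (fun ω => ∑ k ∈ Finset.range n, Y k ω) μ :=
      Finset.aemeasurable_fun_sum _ fun k _ => hm k
    have hsplit : {ω | ∑ k ∈ Finset.range (n + 1), Y k ω = s} =
        ⋃ ab ∈ Finset.HasAntidiagonal.antidiagonal s,
          ((fun ω => ∑ k ∈ Finset.range n, Y k ω) ⁻¹' {ab.1} ∩ Y n ⁻¹' {ab.2}) := by
      ext ω
      simp [Finset.sum_range_succ, Finset.HasAntidiagonal.mem_antidiagonal]
    rw [hsplit, measureReal_biUnion_finset₀, pow_succ, coeff_mul]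
    · refine Finset.sum_congr rfl fun ab _ => ?_
      rw [measureReal_def, hindep.measure_inter_preimage_eq_mul _ _ MeasurableSet.of_discrete
        MeasurableSet.of_discrete, ENNReal.toReal_mul]
      exact congrArg₂ _ (ih ab.1) (hf n ab.2)
    · intro ab _ cd _ hne
      refine Disjoint.aedisjoint (Set.disjoint_left.mpr fun ω h h' => hne ?_)
      exact Prod.ext (h.1.symm.trans h'.1) (h.2.symm.trans h'.2)
    · intro ab _
      exact (hsum.nullMeasurableSet_preimage MeasurableSet.of_discrete).inter
        ((hm n).nullMeasurableSet_preimage MeasurableSet.of_discrete)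

/-- The `Z k` are the i.i.d. increments, in `{-1, 0, 1}`, of a random walk that moves up with
probability `u` and down with probability `v`. -/
structure IsLazyWalk (Z : ℕ → Ω → ℤ) (u v : ℝ) (μ : Measure Ω) : Prop where
  aemeasurable : ∀ k, AEMeasurable (Z k) μ
  iIndepFun : iIndepFun Z μ
  mem_Icc : ∀ k ω, Z k ω ∈ Set.Icc (-1) 1
  real_up : ∀ k, μ.real {ω | Z k ω = 1} = u
  real_down : ∀ k, μ.real {ω | Z k ω = -1} = v

namespace IsLazyWalk

variable [IsProbabilityMeasure μ] {Z : ℕ → Ω → ℤ}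

theorem real_stay (h : IsLazyWalk Z u v μ) (k : ℕ) : μ.real {ω | Z k ω = 0} = 1 - u - v := by
  have hnull : ∀ z, NullMeasurableSet {ω | Z k ω = z} μ := fun z =>
    (h.aemeasurable k).nullMeasurableSet_preimage (measurableSet_singleton z)
  have hcompl : {ω | Z k ω = 0} = ({ω | Z k ω = 1} ∪ {ω | Z k ω = -1})ᶜ := by
    ext ω
    obtain ⟨hlow, hup⟩ := h.mem_Icc k ω
    simp only [Set.mem_ofPred_eq, Set.mem_compl_iff, Set.mem_union]
    omega
  have hdisj : Disjoint {ω | Z k ω = 1} {ω | Z k ω = -1} :=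
    Set.disjoint_left.mpr fun ω (hup : _ = _) (hdown : _ = _) => by omega
  rw [hcompl, probReal_compl_eq_one_sub₀ ((hnull _).union (hnull _)),
    measureReal_union₀ (hnull _) hdisj.aedisjoint, h.real_up, h.real_down]
  ring

theorem add_le_one (h : IsLazyWalk Z u v μ) : u + v ≤ 1 := by
  linarith [h.real_stay 0, measureReal_nonneg (μ := μ) (s := {ω | Z 0 ω = 0})]

theorem real_toNat_eq_coeff (h : IsLazyWalk Z u v μ) (k s : ℕ) :
    μ.real {ω | (Z k ω + 1).toNat = s} = (lazyPoly u v).coeff s := by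
  have hiff : ∀ ω, (Z k ω + 1).toNat = s ↔ Z k ω = s - 1 := fun ω => by
    obtain ⟨hlow, -⟩ := h.mem_Icc k ω
    omega
  simp only [hiff, coeff_lazyPoly]
  split_ifs with h0 h1 h2
  · simpa [h0] using h.real_down k
  · simpa [h1] using h.real_stay k
  · simpa [h2] using h.real_up k
  · suffices {ω | Z k ω = s - 1} = ∅ by rw [this, measureReal_empty]
    refine Set.eq_empty_of_forall_notMem fun ω (hω : _ = _) => ?_
    obtain ⟨-, hup⟩ := h.mem_Icc k ω
    omega

theorem real_sum_eq_coeff (h : IsLazyWalk Z u v μ) (n s : ℕ) :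
    μ.real {ω | ∑ k ∈ Finset.range n, Z k ω = (s : ℤ) - n} = (lazyPoly u v ^ n).coeff s := by
  rw [← measureReal_sum_eq_coeff_pow (Y := fun k ω => (Z k ω + 1).toNat)
    (fun k => (Measurable.of_discrete (f := fun z : ℤ => (z + 1).toNat)).comp_aemeasurable
      (h.aemeasurable k))
    (h.iIndepFun.comp (fun _ z => (z + 1).toNat) fun _ => Measurable.of_discrete)
    h.real_toNat_eq_coeff]
  congr! 3 with ω
  have hshift : ((∑ k ∈ Finset.range n, (Z k ω + 1).toNat : ℕ) : ℤ) =
      ∑ k ∈ Finset.range n, Z k ω + n := by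
    have hcast : ∀ k, ((Z k ω + 1).toNat : ℤ) = Z k ω + 1 := fun k =>
      Int.toNat_of_nonneg (by linarith [(h.mem_Icc k ω).1])
    simp [hcast, Finset.sum_add_distrib]
  omega

theorem real_sum_nonpos_le (h : IsLazyWalk Z u v μ) (hv : 0 < v) (hvu : v ≤ u) (n : ℕ) :
    μ.real {ω | ∑ k ∈ Finset.range n, Z k ω ≤ 0} ≤ crossoverBase u v ^ n := by
  refine le_trans ?_ (sum_range_coeff_lazyPoly_pow_le hv hvu h.add_le_one n)
  have hcover : {ω | ∑ k ∈ Finset.range n, Z k ω ≤ 0} ⊆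
      ⋃ s ∈ Finset.range (n + 1), {ω | ∑ k ∈ Finset.range n, Z k ω = (s : ℤ) - n} := by
    intro ω (hω : ∑ k ∈ Finset.range n, Z k ω ≤ 0)
    have hlow : -(n : ℤ) ≤ ∑ k ∈ Finset.range n, Z k ω := by
      simpa using Finset.card_nsmul_le_sum (Finset.range n) (fun k => Z k ω) (-1)
        fun k _ => (h.mem_Icc k ω).1
    simp only [Set.mem_iUnion, Finset.mem_range, Set.mem_ofPred_eq, exists_prop]
    exact ⟨(∑ k ∈ Finset.range n, Z k ω + n).toNat, by omega, by omega⟩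
  refine (measureReal_mono hcover (measure_ne_top _ _)).trans
    ((measureReal_biUnion_finset_le _ _).trans_eq ?_)
  exact Finset.sum_congr rfl fun s _ => h.real_sum_eq_coeff n s

theorem le_real_sum_neg (h : IsLazyWalk Z u v μ) (hu : 0 < u) (hv : 0 < v) {n : ℕ} (hn : 0 < n) :
    v * (1 - u - v) * (crossoverBase u v ^ n / n) ≤
      μ.real {ω | ∑ k ∈ Finset.range n, Z k ω < 0} := by
  obtain ⟨m, rfl⟩ := Nat.exists_eq_add_one_of_ne_zero hn.ne'
  have hcoeff := le_coeff_lazyPoly_pow_succ hu hv h.add_le_one m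
  rw [← h.real_sum_eq_coeff, ← Nat.cast_add_one] at hcoeff
  refine hcoeff.trans (measureReal_mono fun ω (hω : _ = _) => ?_)
  rw [Set.mem_ofPred_eq, hω]
  omega

end IsLazyWalk

end LazyWalk

section Crossover

/-- The probability that an odd number among `m` independent events of probability `θ` occurs. -/
noncomputable def oddProb (θ : ℝ) (m : ℕ) : ℝ := (1 - (1 - 2 * θ) ^ m) / 2

theorem le_oddProb {θ : ℝ} (h0 : 0 ≤ θ) (h1 : θ ≤ 1 / 2) {m : ℕ} (hm : 0 < m) :
    θ ≤ oddProb θ m := by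
  have hpow : (1 - 2 * θ) ^ m ≤ 1 - 2 * θ :=
    pow_le_of_le_one (by linarith) (by linarith) hm.ne'
  rw [oddProb]
  linarith

section PathLaw

variable {V : Type*} {T : SimpleGraph V} {i j : V} {e : Sym2 V}

theorem sgn_differ_mul_sgn_differ_ends [DecidableEq V] {w : T.Walk i j} (hw : w.IsPath)
    (he : e ∈ w.edges) (x : V → Bool) : sgn (differ x e) * sgn (differ x s(i, j)) =
      ∏ e' ∈ w.edges.toFinset.erase e, sgn (differ x e') := by
  rw [sgn_differ_eq_prod_edges x w, ← List.prod_toFinset _ hw.isTrail.edges_nodup,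
    ← Finset.mul_prod_erase _ _ (List.mem_toFinset.mpr he), ← mul_assoc, sgn_mul_self, one_mul]

variable [Fintype T.edgeSet]

theorem sum_density_mul_prod_erase_sgn [Fintype V] [DecidableEq V] (hT : T.IsTree) (θ : ℝ)
    {F : Finset (Sym2 V)} (hF : F ⊆ T.edgeFinset) (he : e ∈ F) (b : Bool) :
    ∑ x, density θ T x *
        ((if differ x e = b then 1 else 0) * ∏ e' ∈ F.erase e, sgn (differ x e')) =
      bern θ b * (1 - 2 * θ) ^ (F.card - 1) := by
  obtain ⟨r⟩ := hT.connected.nonempty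
  have hsum := sum_density_mul hT θ r (fun _ => 1) hF fun e' c =>
    if e' = e then if c = b then 1 else 0 else sgn c
  have hflip : ∀ e' ∈ F.erase e,
      ∑ c, bern θ c * (if e' = e then if c = b then 1 else 0 else sgn c) = 1 - 2 * θ := by
    intro e' he'
    simp only [if_neg (Finset.ne_of_mem_erase he'), Fintype.sum_bool, bern, sgn]
    norm_num
    ring
  rw [← Finset.mul_prod_erase F _ he, Finset.prod_congr rfl hflip, Finset.prod_const,
    Finset.card_erase_of_mem he] at hsum
  simp only [← Finset.mul_prod_erase F _ he, if_true, mul_ite, mul_one, mul_zero, one_mul,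
    Finset.sum_ite_eq', Finset.mem_univ] at hsum
  rw [Fintype.sum_bool] at hsum
  refine Eq.trans ?_ (hsum.trans (by norm_num))
  refine Finset.sum_congr rfl fun x _ => ?_
  rw [Finset.prod_congr rfl fun e' he' => if_neg (Finset.ne_of_mem_erase he')]

theorem measureReal_differ_eq_and_ends_ne [Finite V] {θ : ℝ} {P : Measure (V → Bool)}
    [IsFiniteMeasure P] (hT : T.IsTree) (hP : ∀ x, P.real {x} = density θ T x) {w : T.Walk i j}
    (hw : w.IsPath) (he : e ∈ w.edges) (b : Bool) :
    P.real {x | differ x e = b ∧ differ x s(i, j) = !b} =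
      bern θ b * oddProb θ (w.length - 1) := by
  classical
  cases nonempty_fintype V
  have hF : w.edges.toFinset ⊆ T.edgeFinset := fun e' he' =>
    SimpleGraph.mem_edgeFinset.mpr (w.edges_subset_edgeSet (List.mem_toFinset.mp he'))
  have he' : e ∈ w.edges.toFinset := List.mem_toFinset.mpr he
  have hcard : w.edges.toFinset.card = w.length := by
    rw [List.toFinset_card_of_nodup hw.isTrail.edges_nodup, SimpleGraph.Walk.length_edges]
  have hedge := sum_density_mul_prod_erase_sgn hT θ
    (Finset.singleton_subset_iff.mpr (hF he')) (Finset.mem_singleton_self e) b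
  have hpath := sum_density_mul_prod_erase_sgn hT θ hF he' b
  simp only [← sgn_differ_mul_sgn_differ_ends hw he, hcard] at hpath
  simp only [Finset.erase_singleton, Finset.prod_empty, mul_one, Finset.card_singleton,
    Nat.sub_self, pow_zero] at hedge
  have hindicator : ∀ x : V → Bool,
      (if differ x e = b ∧ differ x s(i, j) = !b then 1 else 0 : ℝ) =
        ((if differ x e = b then 1 else 0) - (if differ x e = b then 1 else 0) *
          (sgn (differ x e) * sgn (differ x s(i, j)))) / 2 := by
    intro x
    cases differ x e <;> cases differ x s(i, j) <;> cases b <;> norm_num [sgn]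
  simp only [measureReal_setOf_eq_sum, hP, hindicator, mul_div_assoc', mul_sub,
    ← Finset.sum_div, Finset.sum_sub_distrib, hedge, hpath]
  rw [oddProb]
  ring

end PathLaw

/-- The increment of the difference between the numbers of samples that disagree at the ends of `e'`
and at the ends of `e`. -/
def crossoverStep {V : Type*} (e' e : Sym2 V) (x : V → Bool) : ℤ :=
  (differ x e').toNat - (differ x e).toNat

theorem sum_crossoverStep {V : Type*} (x : ℕ → V → Bool) (e' e : Sym2 V) (n : ℕ) :
    ∑ k ∈ Finset.range n, crossoverStep e' e (x k) =
      (disagreements (fun k : Fin n => x k) e' : ℤ) - disagreements (fun k : Fin n => x k) e := by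
  simp only [crossoverStep, disagreements, Finset.sum_range, Finset.sum_sub_distrib, Nat.cast_sum]

theorem crossoverBase_flip {θ : ℝ} (h0 : 0 ≤ θ) (h1 : θ ≤ 1) {Q : ℝ} (hQ : 0 ≤ Q) :
    crossoverBase ((1 - θ) * Q) (θ * Q) = 1 - Q * (1 - √(4 * θ * (1 - θ))) := by
  have hsqrt : √(4 * θ * (1 - θ)) = 2 * (√(1 - θ) * √θ) := by
    rw [mul_assoc, Real.sqrt_mul (by norm_num), mul_comm θ, Real.sqrt_mul (by linarith),
      show (4 : ℝ) = 2 ^ 2 by norm_num, Real.sqrt_sq (by norm_num)]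
  rw [crossoverBase_eq (mul_nonneg (by linarith) hQ) (mul_nonneg h0 hQ), hsqrt,
    Real.sqrt_mul (by linarith), Real.sqrt_mul h0]
  linear_combination 2 * √(1 - θ) * √θ * Real.mul_self_sqrt hQ

variable {p : ℕ} {θ : ℝ} {T : SimpleGraph (Fin p)} {P : Measure (Fin p → Bool)}
  {Ω : Type*} [MeasurableSpace Ω] {μ : Measure Ω} {X : ℕ → Ω → Fin p → Bool}

theorem isLazyWalk_crossoverStep (hP : IsTreeModel θ T P) (h0 : 0 < θ) (h1 : θ < 1)
    (hXlaw : ∀ k, HasLaw (X k) P μ) (hXindep : iIndepFun X μ) {i j : Fin p} {w : T.Walk i j}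
    (hw : w.IsPath) {e : Sym2 (Fin p)} (he : e ∈ w.edges) :
    IsLazyWalk (fun k ω => crossoverStep s(i, j) e (X k ω))
      ((1 - θ) * oddProb θ (w.length - 1)) (θ * oddProb θ (w.length - 1)) μ := by
  classical
  have := hP.isProbabilityMeasure
  have hlaw : ∀ b k, μ.real {ω | differ (X k ω) e = b ∧ differ (X k ω) s(i, j) = !b} =
      bern θ b * oddProb θ (w.length - 1) := fun b k => by
    rw [← measureReal_differ_eq_and_ends_ne hP.isTree (hP.real_singleton h0 h1) hw he b,
      measureReal_def, measureReal_def, ← (hXlaw k).map_eq,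
      Measure.map_apply_of_aemeasurable (hXlaw k).aemeasurable MeasurableSet.of_discrete]
    rfl
  refine ⟨fun k => (Measurable.of_discrete (f := crossoverStep s(i, j) e)).comp_aemeasurable
    (hXlaw k).aemeasurable, hXindep.comp (fun _ => crossoverStep s(i, j) e)
    fun _ => Measurable.of_discrete, fun k ω => ?_, fun k => ?_, fun k => ?_⟩
  · rw [crossoverStep]
    cases differ (X k ω) s(i, j) <;> cases differ (X k ω) e <;> simp
  · refine Eq.trans ?_ (hlaw false k)
    congr! 3 with ω
    rw [crossoverStep]
    cases differ (X k ω) s(i, j) <;> cases differ (X k ω) e <;> simp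
  · refine Eq.trans ?_ (hlaw true k)
    congr! 3 with ω
    rw [crossoverStep]
    cases differ (X k ω) s(i, j) <;> cases differ (X k ω) e <;> simp

end Crossover

section Exponent

theorem tendsto_neg_log_div {f : ℕ → ℝ} {ρ K M : ℝ} (hρ : 0 < ρ) (hK : 0 < K)
    (hlow : ∀ n : ℕ, 0 < n → K * (ρ ^ n / n) ≤ f n) (hup : ∀ n : ℕ, 0 < n → f n ≤ M * ρ ^ n) :
    Tendsto (fun n : ℕ => -(1 / (n : ℝ)) * Real.log (f n)) atTop (𝓝 (-Real.log ρ)) := by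
  have hM : 0 < M := by
    have := (hlow 1 one_pos).trans (hup 1 one_pos)
    rw [pow_one, Nat.cast_one, div_one] at this
    exact hK.trans_le (le_of_mul_le_mul_right this hρ)
  have hconst : ∀ c : ℝ, Tendsto (fun n : ℕ => c / n) atTop (𝓝 0) :=
    tendsto_const_div_atTop_nhds_zero_nat
  have hlog : Tendsto (fun n : ℕ => Real.log n / n) atTop (𝓝 0) :=
    Real.isLittleO_log_id_atTop.tendsto_div_nhds_zero.comp tendsto_natCast_atTop_atTop
  have hlim_low : Tendsto (fun n : ℕ => -Real.log ρ - Real.log M / n) atTop (𝓝 (-Real.log ρ)) := by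
    simpa using (hconst (Real.log M)).const_sub (-Real.log ρ)
  have hlim_up : Tendsto (fun n : ℕ => -Real.log ρ - Real.log K / n + Real.log n / n) atTop
      (𝓝 (-Real.log ρ)) := by
    simpa using ((hconst (Real.log K)).const_sub (-Real.log ρ)).add hlog
  refine tendsto_of_tendsto_of_tendsto_of_le_of_le' hlim_low hlim_up ?_ ?_ <;>
    filter_upwards [eventually_gt_atTop 0] with n hn <;>
    have hn' : (0 : ℝ) < n := Nat.cast_pos.mpr hn
  · have hpos : 0 < f n := lt_of_lt_of_le (by positivity) (hlow n hn)
    have hle := Real.log_le_log hpos (hup n hn)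
    rw [Real.log_mul hM.ne' (pow_pos hρ n).ne', Real.log_pow] at hle
    field_simp
    linarith
  · have hle := Real.log_le_log (by positivity) (hlow n hn)
    rw [Real.log_mul hK.ne' (by positivity), Real.log_div (pow_pos hρ n).ne' hn'.ne',
      Real.log_pow] at hle
    field_simp
    linarith

theorem measureReal_mono_ae {Ω : Type*} [MeasurableSpace Ω] {μ : Measure Ω} [IsFiniteMeasure μ]
    {A B : Set Ω} (h : ∀ᵐ ω ∂μ, ω ∈ A → ω ∈ B) : μ.real A ≤ μ.real B :=
  ENNReal.toReal_mono (measure_ne_top μ B) (measure_mono_ae h)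

theorem sqrt_four_mul_one_sub_le_one (θ : ℝ) : √(4 * θ * (1 - θ)) ≤ 1 :=
  Real.sqrt_le_one.mpr (by nlinarith [sq_nonneg (2 * θ - 1)])

variable {p n : ℕ} {θ : ℝ} {T : SimpleGraph (Fin p)} {P : Measure (Fin p → Bool)}
  {Ω : Type*} [MeasurableSpace Ω] {μ : Measure Ω} [IsProbabilityMeasure μ]
  {X : ℕ → Ω → Fin p → Bool}

theorem measureReal_crossover_le (hP : IsTreeModel θ T P) (h0 : 0 < θ) (h1 : θ < 1 / 2)
    (hXlaw : ∀ k, HasLaw (X k) P μ) (hXindep : iIndepFun X μ)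
    {q : Sym2 (Fin p) × Sym2 (Fin p)} (hq : q ∈ crossoverPairs T) (n : ℕ) :
    μ.real {ω | disagreements (fun k : Fin n => X k ω) q.1 ≤
      disagreements (fun k : Fin n => X k ω) q.2} ≤
        (1 - θ * (1 - √(4 * θ * (1 - θ)))) ^ n := by
  obtain ⟨e', e⟩ := q
  obtain ⟨i, j, w, hw, hnadj, rfl, he⟩ := hq
  have hlength : 0 < w.length - 1 := by
    have hpos : 0 < w.length := w.length_edges ▸ List.length_pos_of_mem he
    have hne : w.length ≠ 1 := fun h => hnadj (SimpleGraph.Walk.adj_of_length_eq_one h)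
    omega
  have hwalk := isLazyWalk_crossoverStep hP h0 (by linarith) hXlaw hXindep hw he
  have hθQ : θ ≤ oddProb θ (w.length - 1) := le_oddProb h0.le h1.le hlength
  set Q := oddProb θ (w.length - 1)
  have hQ : 0 < Q := h0.trans_le hθQ
  have hbound := hwalk.real_sum_nonpos_le (mul_pos h0 hQ)
    (mul_le_mul_of_nonneg_right (by linarith) hQ.le) n
  simp only [sum_crossoverStep, sub_nonpos, Nat.cast_le] at hbound
  refine hbound.trans (pow_le_pow_left₀ ?_ ?_ n)
  · exact crossoverBase_nonneg (mul_nonneg (by linarith) hQ.le) (by positivity) hwalk.add_le_one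
  · rw [crossoverBase_flip h0.le (by linarith) hQ.le]
    exact sub_le_sub_left (mul_le_mul_of_nonneg_right hθQ
      (sub_nonneg.mpr (sqrt_four_mul_one_sub_le_one θ))) 1

theorem le_measureReal_crossover_lt (hP : IsTreeModel θ T P) (h0 : 0 < θ) (h1 : θ < 1)
    (hXlaw : ∀ k, HasLaw (X k) P μ) (hXindep : iIndepFun X μ) {a i j : Fin p}
    (hai : T.Adj a i) (haj : T.Adj a j) (hij : i ≠ j) (hn : 0 < n) :
    θ * θ * (1 - θ) * ((1 - θ * (1 - √(4 * θ * (1 - θ)))) ^ n / n) ≤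
      μ.real {ω | disagreements (fun k : Fin n => X k ω) s(i, j) <
        disagreements (fun k : Fin n => X k ω) s(a, i)} := by
  let w : T.Walk i j := .cons hai.symm (.cons haj .nil)
  have hw : w.IsPath := by simp [w, SimpleGraph.Walk.cons_isPath_iff, hai.ne', haj.ne, hij]
  have hwalk := isLazyWalk_crossoverStep hP h0 h1 hXlaw hXindep hw (e := s(a, i))
    (by simp [w, Sym2.eq_swap])
  have hodd : oddProb θ (w.length - 1) = θ := by
    rw [show w.length = 2 from rfl, oddProb]
    ring
  rw [hodd] at hwalk
  have hbound := hwalk.le_real_sum_neg (mul_pos (by linarith) h0) (mul_pos h0 h0) hn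
  simpa only [sum_crossoverStep, sub_neg, Nat.cast_lt, crossoverBase_flip h0.le h1.le h0.le,
    show 1 - (1 - θ) * θ - θ * θ = 1 - θ by ring] using hbound

variable {Q : Ω → Measure (Fin p → Bool)} {T' : Ω → SimpleGraph (Fin p)}

theorem measureReal_ne_le (hP : IsTreeModel θ T P) (h0 : 0 < θ) (h1 : θ < 1 / 2)
    (hXlaw : ∀ k, HasLaw (X k) P μ) (hXindep : iIndepFun X μ)
    (hML : ∀ᵐ ω ∂μ, IsMLEstimate θ (fun k : Fin n => X k ω) (Q ω))
    (hQ : ∀ᵐ ω ∂μ, IsTreeModel θ (T' ω) (Q ω)) :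
    μ.real {ω | T' ω ≠ T} ≤ (crossoverPairs T).ncard * (1 - θ * (1 - √(4 * θ * (1 - θ)))) ^ n := by
  have hfin : (crossoverPairs T).Finite := Set.toFinite _
  calc μ.real {ω | T' ω ≠ T}
      ≤ μ.real (⋃ q ∈ hfin.toFinset, {ω | disagreements (fun k : Fin n => X k ω) q.1 ≤
          disagreements (fun k : Fin n => X k ω) q.2}) := by
        refine measureReal_mono_ae ?_
        filter_upwards [hML, hQ] with ω hMLω hQω hne
        obtain ⟨q, hq, hle⟩ := hMLω.exists_crossover h0 h1 hQω hP.isTree hne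
        exact Set.mem_biUnion (hfin.mem_toFinset.mpr hq) hle
    _ ≤ ∑ q ∈ hfin.toFinset, (1 - θ * (1 - √(4 * θ * (1 - θ)))) ^ n :=
        (measureReal_biUnion_finset_le _ _).trans <| Finset.sum_le_sum fun q hq =>
          measureReal_crossover_le hP h0 h1 hXlaw hXindep (hfin.mem_toFinset.mp hq) n
    _ = _ := by rw [Finset.sum_const, nsmul_eq_mul, Set.ncard_eq_toFinset_card _ hfin]

theorem le_measureReal_ne (hp : 2 < p) (hP : IsTreeModel θ T P) (h0 : 0 < θ) (h1 : θ < 1 / 2)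
    (hXlaw : ∀ k, HasLaw (X k) P μ) (hXindep : iIndepFun X μ)
    (hML : ∀ᵐ ω ∂μ, IsMLEstimate θ (fun k : Fin n => X k ω) (Q ω))
    (hQ : ∀ᵐ ω ∂μ, IsTreeModel θ (T' ω) (Q ω)) (hn : 0 < n) :
    θ * θ * (1 - θ) * ((1 - θ * (1 - √(4 * θ * (1 - θ)))) ^ n / n) ≤
      μ.real {ω | T' ω ≠ T} := by
  obtain ⟨a, i, j, hai, haj, hij⟩ := exists_two_neighbors hP.isTree (by simpa using hp)
  refine (le_measureReal_crossover_lt hP h0 (by linarith) hXlaw hXindep hai haj hij hn).trans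
    (measureReal_mono_ae ?_)
  filter_upwards [hML, hQ] with ω hMLω hQω hlt
  exact hMLω.ne_of_disagreements_lt h0 h1 hQω hai haj hij hlt

end Exponent

end TreeLearning

/-- `X 0, X 1, …` are i.i.d. samples from the tree model `P` with tree `T`; for every `n`, `PML n`
is a maximum likelihood estimate based on the first `n` samples (ties broken in any way, possibly
at random) and `TML n` is its tree. -/
theorem mainTheorem3 {p : ℕ} (hp : 2 < p) {θ : ℝ} (hθ0 : 0 < θ) (hθ1 : θ < 1 / 2)
    {T : SimpleGraph (Fin p)} {P : Measure (Fin p → Bool)}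
    (hP : TreeLearning.IsTreeModel θ T P)
    {Ω : Type*} [MeasurableSpace Ω] {μ : Measure Ω} [IsProbabilityMeasure μ]
    {X : ℕ → Ω → Fin p → Bool}
    (hXlaw : ∀ k, HasLaw (X k) P μ) (hXindep : iIndepFun X μ)
    {PML : ℕ → Ω → Measure (Fin p → Bool)} {TML : ℕ → Ω → SimpleGraph (Fin p)}
    (hPML : ∀ n, ∀ᵐ ω ∂μ,
      TreeLearning.IsMLEstimate θ (fun k : Fin n => X k ω) (PML n ω))
    (hTML : ∀ n, ∀ᵐ ω ∂μ, TreeLearning.IsTreeModel θ (TML n ω) (PML n ω)) :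
    Tendsto
      (fun n : ℕ => -(1 / (n : ℝ)) * Real.log (μ.real {ω | (TML n ω).edgeSet ≠ T.edgeSet}))
      atTop (𝓝 (-Real.log (1 - θ * (1 - √(4 * θ * (1 - θ)))))) := by
  have hρ : 0 < 1 - θ * (1 - √(4 * θ * (1 - θ))) := by
    nlinarith [Real.sqrt_nonneg (4 * θ * (1 - θ))]
  simp only [ne_eq, SimpleGraph.edgeSet_inj]
  exact TreeLearning.tendsto_neg_log_div hρ (mul_pos (mul_pos hθ0 hθ0) (by linarith))
    (fun n hn => TreeLearning.le_measureReal_ne hp hP hθ0 hθ1 hXlaw hXindep (hPML n) (hTML n) hn)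
    (fun n _ => TreeLearning.measureReal_ne_le hP hθ0 hθ1 hXlaw hXindep (hPML n) (hTML n))
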